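/- \textbf{Theorem (error bounds for the corrected discard approximation).} Let $r>0$, $\epsilon\in[0,1]$, and let $B$ and $C$ be non-negative random variables with finite means, $\mathbb{E}[C]>0$ (in the intended application $B$ is phase-type and $C$ is heavy-tailed, but this is not needed). Put $\delta=r\,\mathbb{E}[B]$, $\theta=r\,\mathbb{E}[C]$ and assume the stability condition $(1-\epsilon)\delta+\epsilon\theta<1$. Consider the Cram\'er--Lundberg model with premium rate $1$ in which claims arrive according to a Poisson process $N$ of rate $r$ and the claim sizes $X_1,X_2,\dots$ are i.i.d., independent of $N$, with distribution function $(1-\epsilon)\mathbb{P}(B\le x)+\epsilon\,\mathbb{P}(C\le x)$. For initial capital $u\ge 0$ let $$\psi_\epsilon(u)=\mathbb{P}\Big(\sup_{t\ge0}\Big(\sum_{i=1}^{N(t)}X_i-t\Big)>u\Big)$$ be its ruin probability. Let $M^\bullet_\epsilon$ be the supremum over $t\ge 0$ of the claim surplus process of the discard model, in which the claim size distribution function is instead $(1-\epsilon)\mathbb{P}(B\le x)+\epsilon$ for $x\ge0$, and let $\psi^\bullet_\epsilon(u)=\mathbb{P}(M^\bullet_\epsilon>u)$. Let $M^\bullet_{\epsilon,0},M^\bullet_{\epsilon,1},\dots$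 be copies of $M^\bullet_\epsilon$ and let $C^e_1,C^e_2,\dots$ have the stationary excess distribution $\mathbb{P}(C^e\le x)=\frac1{\mathbb{E}[C]}\int_0^x\mathbb{P}(C>t)\,dt$ $(x\ge 0)$, all these variables being independent. Put $$L_{\epsilon,n}(u)=\mathbb{P}(M^\bullet_{\epsilon,0}+\dots+M^\bullet_{\epsilon,n}+C^e_1+\dots+C^e_n>u),$$ and define the corrected discard approximation $$\hat\psi_{d,\epsilon}(u)=\psi^\bullet_\epsilon(u)+\frac{\epsilon\theta}{1-\delta+\epsilon\delta}\Big(\mathbb{P}(M^\bullet_{\epsilon,0}+M^\bullet_{\epsilon,1}+C^e_1>u)-\mathbb{P}(M^\bullet_{\epsilon,0}>u)\Big).$$ Then for every $u\ge 0$ one has $\hat\psi_{d,\epsilon}(u)\le\psi_\epsilon(u)$ and $$\Big(\frac{\epsilon\theta}{1-\delta+\epsilon\delta}\Big)^2\big(L_{\epsilon,2}(u)-L_{\epsilon,1}(u)\big)\;\le\;\psi_\epsilon(u)-\hat\psi_{d,\epsilon}(u)\;\le\;\Big(\frac{\epsilon\theta}{1-\delta+\epsilon\delta}\Big)^2 .$$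 -/

import Mathlib

open MeasureTheory ProbabilityTheory

namespace RiskModel

/-- The mixture `(1 - ε) F + ε H` of two laws on `ℝ`, with `ε ∈ [0, 1]`. -/
noncomputable def mixture (ε : ℝ) (F H : Measure ℝ) : Measure ℝ :=
  ENNReal.ofReal (1 - ε) • F + ENNReal.ofReal ε • H

/-- The claim size law of the base model in which the claims of the second kind are discarded,
that is, replaced by claims of size zero: it has the distribution function
`(1 - ε) P(B ≤ x) + ε` for `x ≥ 0`. -/
noncomputable def discardLaw (ε : ℝ) (B : Measure ℝ) : Measure ℝ :=
  mixture ε B (Measure.dirac 0)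

/-- The stationary excess law of a law `F` on `[0, ∞)` with finite positive mean: it has the
density `t ↦ F(t, ∞) / mean F` on `(0, ∞)`. -/
noncomputable def excessLaw (F : Measure ℝ) : Measure ℝ :=
  (volume.restrict (Set.Ioi 0)).withDensity
    (fun t => F (Set.Ioi t) / ENNReal.ofReal (∫ x, x ∂F))

/-- The number of arrivals in `[0, t]` when `τ 0, τ 1, …` are the successive interarrival times:
the `n`-th arrival (counting from `0`) takes place at time `τ 0 + ⋯ + τ n`. -/
noncomputable def arrivalCount (τ : ℕ → ℝ) (t : ℝ) : ℕ :=
  Set.ncard {n : ℕ | ∑ i ∈ Finset.range (n + 1), τ i ≤ t}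

/-- The claim surplus `S(t) = (X 0 + ⋯ + X (N(t) - 1)) - t` at time `t`, with premium rate `1`,
interarrival times `τ` and claim sizes `X`. -/
noncomputable def claimSurplus (τ X : ℕ → ℝ) (t : ℝ) : ℝ :=
  (∑ i ∈ Finset.range (arrivalCount τ t), X i) - t

/-- The supremum over all `t ≥ 0` of the claim surplus, in the extended reals. -/
noncomputable def supSurplus (τ X : ℕ → ℝ) : EReal :=
  ⨆ t : NNReal, ((claimSurplus τ X (t : ℝ) : ℝ) : EReal)

/-- `τ` and `X` are the interarrival times and the claim sizes of a Cramér–Lundberg model on the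
probability space `(Ω, P)`: claims arrive according to a Poisson process of rate `r` (the
interarrival times are i.i.d. exponential with rate `r`), and the claim sizes are i.i.d. with
law `G` and independent of the arrival process. -/
structure IsCramerLundberg {Ω : Type*} [MeasurableSpace Ω] (P : Measure Ω) (r : ℝ)
    (G : Measure ℝ) (τ X : ℕ → Ω → ℝ) : Prop where
  hasLaw_interarrival : ∀ i, HasLaw (τ i) (expMeasure r) P
  hasLaw_claim : ∀ i, HasLaw (X i) G P
  indep : iIndepFun (Sum.elim τ X) P

/-- The supremum of the claim surplus process, as a random variable. -/
noncomputable def maxSurplus {Ω : Type*} (τ X : ℕ → Ω → ℝ) (ω : Ω) : EReal :=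
  supSurplus (fun i => τ i ω) (fun i => X i ω)

/-- The probability of ultimate ruin with initial capital `u`: the supremum of the claim surplus
process exceeds `u`. -/
noncomputable def ruinProb {Ω : Type*} [MeasurableSpace Ω] (P : Measure Ω) (τ X : ℕ → Ω → ℝ)
    (u : ℝ) : ℝ :=
  P.real {ω | (u : EReal) < maxSurplus τ X ω}

/-- `L n u = P(M 0 + M 1 + ⋯ + M n + E 1 + ⋯ + E n > u)`; the variables `E` are indexed
from `0`. -/
noncomputable def tailL {Ω : Type*} [MeasurableSpace Ω] (Q : Measure Ω) (M E : ℕ → Ω → ℝ)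
    (n : ℕ) (u : ℝ) : ℝ :=
  Q.real {ω | u < (∑ i ∈ Finset.range (n + 1), M i ω) + (∑ i ∈ Finset.range n, E i ω)}

/-- The coefficient `ε θ / (1 - δ + ε δ)` of the correction term. -/
noncomputable def corrCoeff (ε δ θ : ℝ) : ℝ := ε * θ / (1 - δ + ε * δ)

/-- The corrected discard approximation: the ruin probability `ψ₀` of the discard base model plus
the correction term `ε θ / (1 - δ + ε δ) * (P(M 0 + M 1 + E 1 > u) - P(M 0 > u))`. -/
noncomputable def correctedDiscard {Ω : Type*} [MeasurableSpace Ω] (Q : Measure Ω)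
    (M E : ℕ → Ω → ℝ) (ψ₀ : ℝ → ℝ) (ε δ θ u : ℝ) : ℝ :=
  ψ₀ u + corrCoeff ε δ θ *
    (Q.real {ω | u < M 0 ω + M 1 ω + E 0 ω} - Q.real {ω | u < M 0 ω})

end RiskModel

/-!
The maximal surplus of a Cramér–Lundberg model with arrival rate `r` and claim law `G` is compound
geometric (Pollaczek–Khinchine). What is used of this is the defective renewal equation
`ν = (1 - ρ) δ₀ + r • (tailMeasure G ∗ ν)` with `ρ = r * mean G`, in one direction: a law `ν` on
`[0, ∞)` that solves it is the law of the maximal surplus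
(`IsCramerLundberg.measure_lt_maxSurplus`). To see this, put `q z = ν (z, ∞)`. By Tonelli the
renewal equation makes `q` harmonic on `[0, ∞)` for the capital process observed at claims
(`lintegral_tail_eq_self`), so the mean of `q` along the process stopped at ruin is constant, equal
to `q u`. After ruin `q = 1`; without ruin the capital tends to `∞` by the strong law of large
numbers, and `q` tends to `0`. Hence `q u` is the probability of ruin.

For the discard model a solution `ν` exists as a geometric series. For the mixture model put
`c = corrCoeff ε δ θ < 1` and let `σ n` be the law of `M 0 + ⋯ + M n + E 0 + ⋯ + E (n - 1)`. As
`tailMeasure` is linear in the claim law, the tail measure of the mixture is that of the discard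
law plus a multiple of the excess law of `C`, and the compound sum `W = (1 - c) ∑ n, c ^ n • σ n`
solves the renewal equation of the mixture model (`renewal_combine`). Therefore
`ψ u = (1 - c) ∑ n, c ^ n * tailL n u`. Since `tailL n u` increases with `n` and lies in `[0, 1]`,
comparing the terms with `n ≥ 2` with `tailL 2 u` and with `1` gives the two bounds
(`geometric_mean_bounds`).
-/

namespace RiskModel

open Set Filter Topology
open scoped ENNReal

/-! ### Tail measures and the harmonic tail -/

/-- The measure on `(0, ∞)` with density `t ↦ F(t, ∞)`: the stationary excess law of `F` before
normalisation. Unlike `excessLaw` it is linear in `F`, and meaningful when `F` has mean zero. -/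
noncomputable def tailMeasure (F : Measure ℝ) : Measure ℝ :=
  (volume.restrict (Ioi 0)).withDensity (fun t => F (Ioi t))

lemma measurable_measure_Ioi (F : Measure ℝ) : Measurable fun t : ℝ => F (Ioi t) :=
  Antitone.measurable fun _ _ h => measure_mono (Ioi_subset_Ioi h)

lemma tailMeasure_univ (F : Measure ℝ) (hF : F (Iio 0) = 0)
    (hint : Integrable (fun x : ℝ => x) F) :
    tailMeasure F univ = ENNReal.ofReal (∫ x, x ∂F) := by
  have h0 : ∀ᵐ x ∂F, (0 : ℝ) ≤ x := by
    rw [ae_iff]; simpa [Iio] using hF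
  rw [ofReal_integral_eq_lintegral_ofReal hint h0,
    lintegral_eq_lintegral_meas_lt F h0 aemeasurable_id, tailMeasure, withDensity_apply _ .univ,
    Measure.restrict_univ]
  rfl

instance sFinite_tailMeasure (F : Measure ℝ) : SFinite (tailMeasure F) := by
  unfold tailMeasure; infer_instance

lemma tailMeasure_Iio (F : Measure ℝ) : tailMeasure F (Iio 0) = 0 := by
  rw [tailMeasure, withDensity_apply _ measurableSet_Iio,
    Measure.restrict_restrict measurableSet_Iio]
  have : Iio (0 : ℝ) ∩ Ioi 0 = ∅ := by ext x; simp; intro h; exact h.le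
  simp [this]

lemma tailMeasure_add (F G : Measure ℝ) :
    tailMeasure (F + G) = tailMeasure F + tailMeasure G := by
  simp only [tailMeasure, Measure.add_apply]
  exact withDensity_add_left (measurable_measure_Ioi F) _

lemma tailMeasure_smul (c : ℝ≥0∞) (F : Measure ℝ) :
    tailMeasure (c • F) = c • tailMeasure F := by
  simp only [tailMeasure, Measure.smul_apply, smul_eq_mul]
  exact withDensity_smul _ (measurable_measure_Ioi F)

lemma tailMeasure_dirac_zero : tailMeasure (Measure.dirac 0) = 0 := by
  rw [tailMeasure, withDensity_eq_zero_iff (measurable_measure_Ioi _).aemeasurable]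
  filter_upwards [ae_restrict_mem measurableSet_Ioi] with t (ht : 0 < t)
  simp [ht.le]

lemma tailMeasure_mixture (ε : ℝ) (F G : Measure ℝ) :
    tailMeasure (mixture ε F G)
      = ENNReal.ofReal (1 - ε) • tailMeasure F + ENNReal.ofReal ε • tailMeasure G := by
  simp only [mixture, tailMeasure_add, tailMeasure_smul]

lemma tailMeasure_discardLaw (ε : ℝ) (F : Measure ℝ) :
    tailMeasure (discardLaw ε F) = ENNReal.ofReal (1 - ε) • tailMeasure F := by
  simp [discardLaw, tailMeasure_mixture, tailMeasure_dirac_zero]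

/-- For independent `W` and `Y` with laws `ν` and `F`, the probability that a level `s` lies in
`[W, W + Y)`. -/
noncomputable def straddle (ν F : Measure ℝ) (s : ℝ) : ℝ≥0∞ :=
  ∫⁻ w in Iic s, F (Ioi (s - w)) ∂ν

lemma straddle_eq (ν F : Measure ℝ) (s : ℝ) :
    straddle ν F s
      = ∫⁻ w, {p : ℝ × ℝ | p.2 ≤ p.1}.indicator (fun p => F (Ioi (p.1 - p.2))) (s, w) ∂ν := by
  rw [straddle, ← lintegral_indicator measurableSet_Iic]
  rfl

lemma measurable_straddle_integrand (F : Measure ℝ) :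
    Measurable ({p : ℝ × ℝ | p.2 ≤ p.1}.indicator (fun p => F (Ioi (p.1 - p.2)))) :=
  ((measurable_measure_Ioi F).comp (measurable_fst.sub measurable_snd)).indicator
    (measurableSet_le measurable_snd measurable_fst)

lemma measurable_straddle (ν F : Measure ℝ) [SFinite ν] : Measurable (straddle ν F) := by
  simp_rw [funext (straddle_eq ν F)]
  exact (measurable_straddle_integrand F).lintegral_prod_right'

/-- The tail of `W + Y` splits according to whether `W` exceeds the level already or the level is
straddled by `Y`. -/
lemma lintegral_measure_Ioi_sub (ν F : Measure ℝ) [SFinite ν] [IsProbabilityMeasure F]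
    (hF : F (Iio 0) = 0) (s : ℝ) :
    ∫⁻ x, ν (Ioi (s - x)) ∂F = ν (Ioi s) + straddle ν F s := by
  have hm : MeasurableSet {p : ℝ × ℝ | s < p.1 + p.2} :=
    measurableSet_lt measurable_const (measurable_fst.add measurable_snd)
  have h1 : (F.prod ν) {p : ℝ × ℝ | s < p.1 + p.2} = ∫⁻ x, ν (Ioi (s - x)) ∂F := by
    rw [Measure.prod_apply hm]
    refine lintegral_congr fun x => congrArg ν ?_
    ext w; simp [sub_lt_iff_lt_add']
  have h2 : (F.prod ν) {p : ℝ × ℝ | s < p.1 + p.2} = ∫⁻ w, F (Ioi (s - w)) ∂ν := by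
    rw [Measure.prod_apply_symm hm]
    refine lintegral_congr fun w => congrArg F ?_
    ext x; simp [sub_lt_iff_lt_add]
  rw [← h1, h2, straddle, ← lintegral_add_compl _ (measurableSet_Iic (a := s)), add_comm]
  congr 1
  rw [compl_Iic, setLIntegral_congr_fun (g := fun _ => 1) measurableSet_Ioi, setLIntegral_one]
  intro w (hw : s < w)
  refine le_antisymm prob_le_one ?_
  refine ((prob_compl_eq_zero_iff measurableSet_Ioi).mp ?_).ge
  rw [compl_Ioi]
  exact measure_mono_null (fun x (hx : x ≤ s - w) => mem_Iio.2 (by linarith)) hF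

lemma tailMeasure_conv_Ioi (ν F : Measure ℝ) [SFinite ν] (u : ℝ) :
    (tailMeasure F ∗ ν) (Ioi u) = ∫⁻ s in Ioi u, straddle ν F s := by
  have hm : MeasurableSet {p : ℝ × ℝ | u < p.1 + p.2} :=
    measurableSet_lt measurable_const (measurable_fst.add measurable_snd)
  have h1 : (tailMeasure F ∗ ν) (Ioi u) = ∫⁻ w, tailMeasure F (Ioi (u - w)) ∂ν := by
    rw [Measure.conv, Measure.map_apply measurable_add measurableSet_Ioi]
    change ((tailMeasure F).prod ν) {p : ℝ × ℝ | u < p.1 + p.2} = _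
    rw [Measure.prod_apply_symm hm]
    refine lintegral_congr fun w => congrArg _ ?_
    ext x; simp [sub_lt_iff_lt_add]
  have h2 (w : ℝ) : tailMeasure F (Ioi (u - w))
      = ∫⁻ s in Ioi u, {p : ℝ × ℝ | p.2 ≤ p.1}.indicator (fun p => F (Ioi (p.1 - p.2))) (s, w) := by
    -- The boundary point is a null set; closing the interval at it matches `straddle`, where the
    -- event `W = s` has to be counted because `ν` may have atoms.
    rw [tailMeasure, withDensity_apply _ measurableSet_Ioi,
      Measure.restrict_restrict measurableSet_Ioi,
      setLIntegral_congr ((ae_eq_refl _).inter Ioi_ae_eq_Ici), ← lintegral_indicator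
      (measurableSet_Ioi.inter measurableSet_Ici), ← lintegral_indicator measurableSet_Ioi,
      ← lintegral_sub_right_eq_self _ w]
    refine lintegral_congr fun s => ?_
    simp only [indicator, mem_inter_iff, mem_Ioi, mem_Ici, mem_ofPred_eq, sub_lt_sub_iff_right,
      sub_nonneg]
    split_ifs <;> tauto
  rw [h1]
  simp_rw [h2, straddle_eq]
  rw [lintegral_lintegral_swap]
  exact ((measurable_straddle_integrand F).comp measurable_swap).aemeasurable

lemma expMeasure_eq_withDensity (r : ℝ) :
    expMeasure r = volume.withDensity (exponentialPDF r) := rfl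

lemma measurable_exponentialPDF (r : ℝ) : Measurable (exponentialPDF r) :=
  (measurable_exponentialPDFReal r).ennreal_ofReal

lemma expMeasure_Iio_zero (r : ℝ) : expMeasure r (Iio 0) = 0 := by
  rw [expMeasure_eq_withDensity, withDensity_apply _ measurableSet_Iio]
  exact lintegral_exponentialPDF_of_nonpos le_rfl

lemma ae_nonneg_expMeasure (r : ℝ) : ∀ᵐ t ∂expMeasure r, 0 ≤ t := by
  rw [ae_iff]; simpa [Iio] using expMeasure_Iio_zero r

lemma expMeasure_Iic {r : ℝ} (hr : 0 < r) {v : ℝ} (hv : 0 ≤ v) :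
    expMeasure r (Iic v) = ENNReal.ofReal (1 - Real.exp (-(r * v))) := by
  rw [expMeasure_eq_withDensity, withDensity_apply _ measurableSet_Iic,
    lintegral_exponentialPDF_eq_antiDeriv hr, if_pos hv]

lemma nullSingletonClass_expMeasure (r : ℝ) : NullSingletonClass (expMeasure r) := by
  rw [expMeasure_eq_withDensity]; infer_instance

/-- The differential equation `f' = r (1 - f)` of the exponential distribution function `f`,
extended by zero to the left of the origin. -/
lemma exponentialPDF_add {r : ℝ} (hr : 0 < r) (v : ℝ) :
    exponentialPDF r v + ENNReal.ofReal r * expMeasure r (Iio v)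
      = (Ici 0).indicator (fun _ => ENNReal.ofReal r) v := by
  have := nullSingletonClass_expMeasure r
  rcases lt_or_ge v 0 with hv | hv
  · rw [indicator_of_notMem (by simpa using hv), exponentialPDF_of_neg hv,
      measure_mono_null (Iio_subset_Iio hv.le) (expMeasure_Iio_zero r)]
    simp
  · have h1 : Real.exp (-(r * v)) ≤ 1 := Real.exp_le_one_iff.2 (by nlinarith)
    rw [indicator_of_mem (by simpa using hv), exponentialPDF_of_nonneg hv,
      measure_congr (Iio_ae_eq_Iic), expMeasure_Iic hr hv, ← ENNReal.ofReal_mul hr.le,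
      ← ENNReal.ofReal_add (by positivity) (mul_nonneg hr.le (by linarith))]
    congr 1; ring

lemma lintegral_expMeasure_shift (r u : ℝ) {f : ℝ → ℝ≥0∞} (hf : Measurable f) :
    ∫⁻ t, f (u + t) ∂expMeasure r = ∫⁻ s, exponentialPDF r (s - u) * f s := by
  rw [expMeasure_eq_withDensity, lintegral_withDensity_eq_lintegral_mul _
    (measurable_exponentialPDF r) (by fun_prop), ← lintegral_sub_right_eq_self _ u]
  simp

/-- If the tail of `ν` is that of `r • (tailMeasure F ∗ ν)` on `[0, ∞)`, then this tail is harmonic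
for the random walk with steps `t - x`, where `t` is exponential and `x` has law `F`, as long as the
walk starts in `[0, ∞)`. -/
lemma lintegral_tail_eq_self {r : ℝ} (hr : 0 < r) (ν F : Measure ℝ) [IsProbabilityMeasure ν]
    [IsProbabilityMeasure F] (hF : F (Iio 0) = 0)
    (hν : ∀ u, 0 ≤ u → ν (Ioi u) = ENNReal.ofReal r * (tailMeasure F ∗ ν) (Ioi u))
    {u : ℝ} (hu : 0 ≤ u) :
    ∫⁻ t, ∫⁻ x, ν (Ioi (u + t - x)) ∂F ∂expMeasure r = ν (Ioi u) := by
  have := isProbabilityMeasure_expMeasure hr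
  have hd := measurable_straddle ν F
  have hp := measurable_exponentialPDF r
  simp_rw [lintegral_measure_Ioi_sub ν F hF]
  have hq : ∫⁻ t, ν (Ioi (u + t)) ∂expMeasure r
      = ∫⁻ s, ENNReal.ofReal r * expMeasure r (Iio (s - u)) * straddle ν F s := by
    have h0 := ae_nonneg_expMeasure r
    have h1 : ∫⁻ t, ν (Ioi (u + t)) ∂expMeasure r
        = ∫⁻ t, (ENNReal.ofReal r * ∫⁻ s,
          {p : ℝ × ℝ | u + p.1 < p.2}.indicator (fun p => straddle ν F p.2) (t, s))
            ∂expMeasure r := by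
      refine lintegral_congr_ae (h0.mono fun t ht => ?_)
      simp only
      rw [hν _ (add_nonneg hu ht), tailMeasure_conv_Ioi, ← lintegral_indicator measurableSet_Ioi]
      rfl
    have hmi : Measurable
        ({p : ℝ × ℝ | u + p.1 < p.2}.indicator (fun p => straddle ν F p.2)) :=
      (hd.comp measurable_snd).indicator
        (measurableSet_lt (measurable_fst.const_add u) measurable_snd)
    rw [h1, lintegral_const_mul _ hmi.lintegral_prod_right',
      lintegral_lintegral_swap (f := fun t s => {p : ℝ × ℝ | u + p.1 < p.2}.indicator
        (fun p => straddle ν F p.2) (t, s)) hmi.aemeasurable, ← lintegral_const_mul]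
    · refine lintegral_congr fun s => ?_
      rw [mul_assoc]
      congr 1
      have : (fun t => {p : ℝ × ℝ | u + p.1 < p.2}.indicator (fun p => straddle ν F p.2) (t, s))
          = (Iio (s - u)).indicator fun _ => straddle ν F s := by
        ext t
        simp only [indicator, mem_ofPred_eq, mem_Iio, lt_sub_iff_add_lt']
      rw [this, lintegral_indicator_const measurableSet_Iio, mul_comm]
    · exact hmi.lintegral_prod_left'
  rw [lintegral_add_right _ (by fun_prop), hq,
    lintegral_expMeasure_shift r u hd, ← lintegral_add_right _ (by fun_prop),
    hν u hu, tailMeasure_conv_Ioi, setLIntegral_congr Ioi_ae_eq_Ici, ← lintegral_const_mul _ hd,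
    ← lintegral_indicator measurableSet_Ici]
  refine lintegral_congr fun s => ?_
  rw [add_comm, ← add_mul, exponentialPDF_add hr]
  simp [indicator, sub_nonneg]

/-! ### The surplus at claim instants and the stopped capital -/

/-- The capital of an insurer with initial capital `u` right after the `n`-th claim, frozen at the
first claim at which it becomes negative. -/
noncomputable def stoppedCapital (u : ℝ) (t x : ℕ → ℝ) : ℕ → ℝ
  | 0 => u
  | n + 1 =>
    if stoppedCapital u t x n < 0 then stoppedCapital u t x n
    else stoppedCapital u t x n + t n - x n

/-- The claim surplus right after the `n`-th claim. -/
def surplusWalk (t x : ℕ → ℝ) (n : ℕ) : ℝ :=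
  ∑ i ∈ Finset.range n, x i - ∑ i ∈ Finset.range n, t i

lemma stoppedCapital_congr (u : ℝ) {t x t' x' : ℕ → ℝ} (n : ℕ) (ht : ∀ i < n, t i = t' i)
    (hx : ∀ i < n, x i = x' i) : stoppedCapital u t x n = stoppedCapital u t' x' n := by
  induction n with
  | zero => rfl
  | succ n ih =>
    rw [stoppedCapital, stoppedCapital, ht n n.lt_succ_self, hx n n.lt_succ_self,
      ih (fun i hi => ht i (hi.trans n.lt_succ_self)) fun i hi => hx i (hi.trans n.lt_succ_self)]

lemma stoppedCapital_eq_of_forall_le {u : ℝ} {t x : ℕ → ℝ} {n : ℕ}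
    (h : ∀ k < n, surplusWalk t x k ≤ u) : stoppedCapital u t x n = u - surplusWalk t x n := by
  induction n with
  | zero => simp [stoppedCapital, surplusWalk]
  | succ n ih =>
    have h1 := ih fun k hk => h k (hk.trans n.lt_succ_self)
    have h2 := h n n.lt_succ_self
    rw [stoppedCapital, h1, if_neg (by linarith)]
    simp only [surplusWalk, Finset.sum_range_succ]
    ring

lemma stoppedCapital_neg_mono {u : ℝ} {t x : ℕ → ℝ} {m n : ℕ} (hmn : m ≤ n)
    (h : stoppedCapital u t x m < 0) : stoppedCapital u t x n < 0 := by
  induction n, hmn using Nat.le_induction with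
  | base => exact h
  | succ n _ ih => rwa [stoppedCapital, if_pos ih]

lemma exists_stoppedCapital_neg {u : ℝ} {t x : ℕ → ℝ} (h : ∃ k, u < surplusWalk t x k) :
    ∃ k, stoppedCapital u t x k < 0 := by
  classical
  refine ⟨Nat.find h, ?_⟩
  rw [stoppedCapital_eq_of_forall_le fun k hk => not_lt.1 (Nat.find_min h hk)]
  linarith [Nat.find_spec h]

lemma measurable_stoppedCapital {α : Type*} [MeasurableSpace α] (u : ℝ) {t x : ℕ → α → ℝ} (n : ℕ)
    (ht : ∀ i, Measurable (t i)) (hx : ∀ i, Measurable (x i)) :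
    Measurable fun a => stoppedCapital u (fun i => t i a) (fun i => x i a) n := by
  induction n with
  | zero => exact measurable_const
  | succ n ih =>
    exact Measurable.ite (measurableSet_lt ih measurable_const) ih ((ih.add (ht n)).sub (hx n))

lemma arrivalCount_eq {τ : ℕ → ℝ} (hτ : ∀ i, 0 < τ i) {s : ℝ} {k : ℕ}
    (h1 : ∑ i ∈ Finset.range k, τ i ≤ s) (h2 : s < ∑ i ∈ Finset.range (k + 1), τ i) :
    arrivalCount τ s = k := by
  have hmono : Monotone fun n => ∑ i ∈ Finset.range n, τ i :=
    monotone_nat_of_le_succ fun n => by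
      rw [Finset.sum_range_succ]; exact le_add_of_nonneg_right (hτ n).le
  have : {n : ℕ | ∑ i ∈ Finset.range (n + 1), τ i ≤ s} = (Finset.range k : Set ℕ) := by
    ext n
    simp only [mem_ofPred_eq, Finset.coe_range, mem_Iio]
    refine ⟨fun h => ?_, fun h => (hmono (Nat.succ_le_of_lt h)).trans h1⟩
    by_contra! hk
    exact absurd ((hmono (Nat.succ_le_succ hk)).trans h) (not_le.2 h2)
  rw [arrivalCount, this, ncard_coe_finset, Finset.card_range]

/-- Between claims the surplus decreases, so its supremum is attained at the origin or right after
a claim. -/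
lemma lt_supSurplus_iff {τ X : ℕ → ℝ} (hτ : ∀ i, 0 < τ i)
    (hlim : Tendsto (fun n => ∑ i ∈ Finset.range n, τ i) atTop atTop) (v : ℝ) :
    (v : EReal) < supSurplus τ X ↔ ∃ k, v < surplusWalk τ X k := by
  classical
  rw [supSurplus, lt_iSup_iff]
  constructor
  · rintro ⟨s, hs⟩
    have hex : ∃ n, (s : ℝ) < ∑ i ∈ Finset.range (n + 1), τ i :=
      (((tendsto_add_atTop_iff_nat 1).2 hlim).eventually_gt_atTop (s : ℝ)).exists
    have hle : ∑ i ∈ Finset.range (Nat.find hex), τ i ≤ s := by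
      rcases Nat.eq_zero_or_pos (Nat.find hex) with h | h
      · simp [h]
      · obtain ⟨m, hm⟩ := Nat.exists_eq_succ_of_ne_zero h.ne'
        have := Nat.find_min hex (m := m) (by omega)
        rw [hm]
        exact not_lt.1 this
    refine ⟨Nat.find hex, ?_⟩
    rw [EReal.coe_lt_coe_iff, claimSurplus, arrivalCount_eq hτ hle (Nat.find_spec hex)] at hs
    exact hs.trans_le (sub_le_sub_left hle _)
  · rintro ⟨k, hk⟩
    refine ⟨⟨∑ i ∈ Finset.range k, τ i, Finset.sum_nonneg fun i _ => (hτ i).le⟩, ?_⟩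
    rw [EReal.coe_lt_coe_iff, claimSurplus]
    have hN : arrivalCount τ (∑ i ∈ Finset.range k, τ i) = k :=
      arrivalCount_eq hτ le_rfl (by
        rw [Finset.sum_range_succ]; exact lt_add_of_pos_right _ (hτ k))
    change v < ∑ i ∈ Finset.range (arrivalCount τ (∑ i ∈ Finset.range k, τ i)), X i - _
    rw [hN]
    exact hk

lemma lintegral_id_expMeasure {r : ℝ} (hr : 0 < r) :
    ∫⁻ t, ENNReal.ofReal t ∂expMeasure r = ENNReal.ofReal r⁻¹ := by
  have := isProbabilityMeasure_expMeasure hr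
  have h0 := ae_nonneg_expMeasure r
  have h1 : ∀ t ∈ Ici (0 : ℝ),
      expMeasure r (Ioi t) = ENNReal.ofReal r⁻¹ * exponentialPDF r t := by
    intro t (ht : 0 ≤ t)
    have hle : Real.exp (-(r * t)) ≤ 1 := Real.exp_le_one_iff.2 (by nlinarith)
    rw [← compl_Iic, prob_compl_eq_one_sub measurableSet_Iic, expMeasure_Iic hr ht,
      exponentialPDF_of_nonneg ht, ← ENNReal.ofReal_mul (by positivity), ← ENNReal.ofReal_one,
      ← ENNReal.ofReal_sub _ (by linarith)]
    congr 1
    field_simp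
    ring
  have h2 : ∫⁻ t in Ici 0, exponentialPDF r t = 1 := by
    rw [← withDensity_apply _ measurableSet_Ici, ← expMeasure_eq_withDensity, ← compl_Iio,
      prob_compl_eq_one_iff measurableSet_Iio, expMeasure_Iio_zero]
  rw [lintegral_eq_lintegral_meas_lt _ h0 aemeasurable_id, setLIntegral_congr Ioi_ae_eq_Ici]
  change ∫⁻ t in Ici 0, expMeasure r (Ioi t) = _
  rw [setLIntegral_congr_fun measurableSet_Ici h1,
    lintegral_const_mul _ (measurable_exponentialPDF r), h2, mul_one]

lemma integrable_id_expMeasure {r : ℝ} (hr : 0 < r) :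
    Integrable (fun t : ℝ => t) (expMeasure r) := by
  have h0 := ae_nonneg_expMeasure r
  refine ⟨aestronglyMeasurable_id, ?_⟩
  rw [hasFiniteIntegral_iff_ofReal h0, lintegral_id_expMeasure hr]
  exact ENNReal.ofReal_lt_top

lemma integral_id_expMeasure {r : ℝ} (hr : 0 < r) : ∫ t, t ∂expMeasure r = r⁻¹ := by
  have h0 := ae_nonneg_expMeasure r
  rw [integral_eq_lintegral_of_nonneg_ae h0 aestronglyMeasurable_id, lintegral_id_expMeasure hr,
    ENNReal.toReal_ofReal (by positivity)]

/-! ### The law of the maximal surplus -/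

section CramerLundberg

variable {Ω : Type*} [MeasurableSpace Ω] {P : Measure Ω} {r : ℝ}
  {G : Measure ℝ} {τ X : ℕ → Ω → ℝ}

/-- The strong law of large numbers for a sequence with a common integrable law. -/
lemma ae_tendsto_average {Y : ℕ → Ω → ℝ} (hY : ∀ i, HasLaw (Y i) G P)
    (hint : Integrable (fun x : ℝ => x) G)
    (hindep : Pairwise fun i j => IndepFun (Y i) (Y j) P) :
    ∀ᵐ ω ∂P, Tendsto (fun n : ℕ => (∑ i ∈ Finset.range n, Y i ω) / n) atTop (𝓝 (∫ x, x ∂G)) := by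
  have h0 : Integrable (Y 0) P := by
    have := (hY 0).map_eq ▸ hint
    exact this.comp_aemeasurable (hY 0).aemeasurable
  have hm : P[Y 0] = ∫ x, x ∂G := by
    rw [← (hY 0).map_eq, integral_map (hY 0).aemeasurable (by fun_prop)]
  rw [← hm]
  refine strong_law_ae_real Y h0 hindep fun i =>
    ⟨(hY i).aemeasurable, (hY 0).aemeasurable, by rw [(hY i).map_eq, (hY 0).map_eq]⟩

lemma IsCramerLundberg.aemeasurable_sumElim (h : IsCramerLundberg P r G τ X) (i : ℕ ⊕ ℕ) :
    AEMeasurable (Sum.elim τ X i) P := by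
  cases i with
  | inl i => exact (h.hasLaw_interarrival i).aemeasurable
  | inr i => exact (h.hasLaw_claim i).aemeasurable

lemma IsCramerLundberg.ae_interarrival_pos (h : IsCramerLundberg P r G τ X) (hr : 0 < r) :
    ∀ᵐ ω ∂P, ∀ i, 0 < τ i ω := by
  have := isProbabilityMeasure_expMeasure hr
  refine ae_all_iff.2 fun i => ?_
  have h1 := (h.hasLaw_interarrival i).measure_eq (p := fun t => ¬ 0 < t)
    measurableSet_Ioi.compl
  rw [ae_iff, h1]
  simp only [not_lt]
  exact (expMeasure_Iic hr le_rfl).trans (by simp)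

lemma IsCramerLundberg.ae_tendsto_interarrival (h : IsCramerLundberg P r G τ X) (hr : 0 < r) :
    ∀ᵐ ω ∂P, Tendsto (fun n : ℕ => (∑ i ∈ Finset.range n, τ i ω) / n) atTop (𝓝 r⁻¹) := by
  rw [← integral_id_expMeasure hr]
  exact ae_tendsto_average h.hasLaw_interarrival (integrable_id_expMeasure hr) fun i j hij =>
    h.indep.indepFun (i := Sum.inl i) (j := Sum.inl j) (by simpa using hij)

lemma IsCramerLundberg.ae_tendsto_claim (h : IsCramerLundberg P r G τ X)
    (hint : Integrable (fun x : ℝ => x) G) :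
    ∀ᵐ ω ∂P, Tendsto (fun n : ℕ => (∑ i ∈ Finset.range n, X i ω) / n) atTop (𝓝 (∫ x, x ∂G)) :=
  ae_tendsto_average h.hasLaw_claim hint fun i j hij =>
    h.indep.indepFun (i := Sum.inr i) (j := Sum.inr j) (by simpa using hij)

lemma tendsto_atTop_of_tendsto_average {a : ℕ → ℝ} {c : ℝ} (hc : 0 < c)
    (h : Tendsto (fun n : ℕ => a n / n) atTop (𝓝 c)) : Tendsto a atTop atTop := by
  refine (h.pos_mul_atTop hc tendsto_natCast_atTop_atTop).congr' ?_
  filter_upwards [eventually_ne_atTop 0] with n hn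
  field_simp

lemma IsCramerLundberg.ae_lt_maxSurplus_iff (h : IsCramerLundberg P r G τ X) (hr : 0 < r) :
    ∀ᵐ ω ∂P, ∀ v : ℝ, (v : EReal) < maxSurplus τ X ω ↔
      ∃ k, v < surplusWalk (fun i => τ i ω) (fun i => X i ω) k := by
  filter_upwards [h.ae_interarrival_pos hr, h.ae_tendsto_interarrival hr] with ω h1 h2 v
  exact lt_supSurplus_iff h1 (tendsto_atTop_of_tendsto_average (inv_pos.2 hr) h2) v

/-- The stopped capital after `n` claims depends only on the first `n` claims and interarrival
times. -/
lemma IsCramerLundberg.indepFun_stoppedCapital (h : IsCramerLundberg P r G τ X) (u : ℝ) (n : ℕ) :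
    IndepFun (fun ω => stoppedCapital u (fun i => τ i ω) (fun i => X i ω) n)
      (fun ω => (τ n ω, X n ω)) P := by
  classical
  let S : Finset (ℕ ⊕ ℕ) := (Finset.range n).disjSum (Finset.range n)
  let T : Finset (ℕ ⊕ ℕ) := {Sum.inl n, Sum.inr n}
  have hST : Disjoint S T := by
    rw [Finset.disjoint_left]
    intro i hi hT
    simp only [T, Finset.mem_insert, Finset.mem_singleton] at hT
    rcases hT with rfl | rfl <;> simp [S] at hi
  -- Reconstruct the two variables from the tuples indexed by `S` and `T`, extending by zero.
  let e : ℕ ⊕ ℕ → (S → ℝ) → ℝ := fun i g => if hi : i ∈ S then g ⟨i, hi⟩ else 0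
  have he : ∀ i, Measurable (e i) := by
    intro i
    by_cases hi : i ∈ S
    · simpa only [e, dif_pos hi] using measurable_pi_apply _
    · simp only [e, dif_neg hi]; exact measurable_const
  have hφ : Measurable fun g : S → ℝ =>
      stoppedCapital u (fun i => e (Sum.inl i) g) (fun i => e (Sum.inr i) g) n :=
    measurable_stoppedCapital u n (fun i => he _) fun i => he _
  have hψ : Measurable fun g : T → ℝ =>
      (g ⟨Sum.inl n, by simp [T]⟩, g ⟨Sum.inr n, by simp [T]⟩) :=
    (measurable_pi_apply _).prodMk (measurable_pi_apply _)
  have key := (h.indep.indepFun_finset₀ S T hST h.aemeasurable_sumElim).comp hφ hψ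
  refine key.congr (ae_of_all _ fun ω => ?_) (ae_of_all _ fun ω => rfl)
  symm
  refine stoppedCapital_congr u n (fun i hi => ?_) fun i hi => ?_
  · have : Sum.inl i ∈ S := by simpa [S] using hi
    simp [e, this]
  · have : Sum.inr i ∈ S := by simpa [S] using hi
    simp [e, this]

lemma IsCramerLundberg.aemeasurable_stoppedCapital (h : IsCramerLundberg P r G τ X) (u : ℝ)
    (n : ℕ) :
    AEMeasurable (fun ω => stoppedCapital u (fun i => τ i ω) (fun i => X i ω) n) P := by
  have h1 : AEMeasurable (fun ω => ((fun i => τ i ω), fun i => X i ω)) P :=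
    (aemeasurable_pi_lambda _ fun i => (h.hasLaw_interarrival i).aemeasurable).prodMk
      (aemeasurable_pi_lambda _ fun i => (h.hasLaw_claim i).aemeasurable)
  have h2 : Measurable fun p : (ℕ → ℝ) × (ℕ → ℝ) => stoppedCapital u p.1 p.2 n :=
    measurable_stoppedCapital u n (t := fun i (p : (ℕ → ℝ) × (ℕ → ℝ)) => p.1 i)
      (x := fun i p => p.2 i)
      (fun i => by fun_prop) fun i => by fun_prop
  exact h2.comp_aemeasurable h1

/-- A function that is one on `(-∞, 0)` and harmonic on `[0, ∞)` for the steps of the capital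
process turns the stopped capital into a process of constant mean. -/
lemma IsCramerLundberg.lintegral_stoppedCapital (h : IsCramerLundberg P r G τ X) (hr : 0 < r)
    [IsProbabilityMeasure G] {q : ℝ → ℝ≥0∞} (hq : Measurable q)
    (hharm : ∀ z, 0 ≤ z → ∫⁻ t, ∫⁻ x, q (z + t - x) ∂G ∂expMeasure r = q z) (u : ℝ) (n : ℕ) :
    ∫⁻ ω, q (stoppedCapital u (fun i => τ i ω) (fun i => X i ω) n) ∂P = q u := by
  have := isProbabilityMeasure_expMeasure hr
  have := h.indep.isProbabilityMeasure
  induction n with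
  | zero => simp [stoppedCapital]
  | succ n ih =>
    have hZ := h.aemeasurable_stoppedCapital u n
    have hτX : AEMeasurable (fun ω => (τ n ω, X n ω)) P :=
      (h.hasLaw_interarrival n).aemeasurable.prodMk (h.hasLaw_claim n).aemeasurable
    have hlaw : P.map (fun ω => (τ n ω, X n ω)) = (expMeasure r).prod G := by
      rw [(h.indep.indepFun (i := Sum.inl n) (j := Sum.inr n) (by simp)).map_prod_eq_prod_map_map
        (h.hasLaw_interarrival n).aemeasurable (h.hasLaw_claim n).aemeasurable]
      exact congrArg₂ _ (h.hasLaw_interarrival n).map_eq (h.hasLaw_claim n).map_eq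
    let Φ : ℝ × ℝ × ℝ → ℝ≥0∞ := fun p => q (if p.1 < 0 then p.1 else p.1 + p.2.1 - p.2.2)
    have hΦ : Measurable Φ :=
      hq.comp (Measurable.ite (measurableSet_lt measurable_fst measurable_const) measurable_fst
        (by fun_prop))
    have h1 := (h.indepFun_stoppedCapital u n).map_prod_eq_prod_map_map hZ hτX
    rw [hlaw] at h1
    have := Measure.isProbabilityMeasure_map hZ (μ := P)
    change ∫⁻ ω, Φ (stoppedCapital u (fun i => τ i ω) (fun i => X i ω) n, τ n ω, X n ω) ∂P = _
    rw [← lintegral_map' (f := Φ) hΦ.aemeasurable (hZ.prodMk hτX), h1,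
      lintegral_prod _ hΦ.aemeasurable, ← ih, ← lintegral_map' hq.aemeasurable hZ]
    refine lintegral_congr fun z => ?_
    by_cases hz : z < 0
    · simp [Φ, hz]
    · rw [← hharm z (not_lt.1 hz), lintegral_prod _ (by fun_prop)]
      simp [Φ, hz]

lemma tendsto_measure_Ioi_atTop (ν : Measure ℝ) [IsProbabilityMeasure ν] :
    Tendsto (fun x => ν (Ioi x)) atTop (𝓝 0) := by
  have h := ENNReal.Tendsto.sub (tendsto_const_nhds (x := (1 : ℝ≥0∞)))
    (tendsto_measure_Iic_atTop ν) (Or.inl ENNReal.one_ne_top)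
  rw [measure_univ, tsub_self] at h
  refine h.congr fun x => ?_
  rw [← compl_Iic, prob_compl_eq_one_sub measurableSet_Iic]

lemma measure_Ioi_of_neg (ν : Measure ℝ) [IsProbabilityMeasure ν] (hν : ν (Iio 0) = 0) {z : ℝ}
    (hz : z < 0) : ν (Ioi z) = 1 := by
  refine (prob_compl_eq_zero_iff measurableSet_Ioi).1 (measure_mono_null ?_ hν)
  intro x hx
  exact (not_lt.1 (show ¬ z < x from hx)).trans_lt hz

/-- **Pollaczek–Khinchine**, in the form of a fixed point equation: if a law `ν` on `[0, ∞)`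
satisfies the defective renewal equation `ν = (1 - ρ) δ₀ + r • (tailMeasure G ∗ ν)`, where
`ρ = r * mean G < 1`, then `ν` is the law of the maximal surplus. Indeed the mean of
`ν (Z, ∞)`, with `Z` the stopped capital, stays constant in time, while `ν (Z, ∞)` tends to the
indicator of ruin because the surplus drifts to `-∞`. -/
theorem IsCramerLundberg.measure_lt_maxSurplus (h : IsCramerLundberg P r G τ X) (hr : 0 < r)
    [IsProbabilityMeasure G] (hG : G (Iio 0) = 0) (hint : Integrable (fun x : ℝ => x) G)
    (hρ : r * ∫ x, x ∂G < 1) (ν : Measure ℝ) [IsProbabilityMeasure ν] (hν0 : ν (Iio 0) = 0)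
    {a : ℝ≥0∞} (hν : ν = a • Measure.dirac 0 + ENNReal.ofReal r • (tailMeasure G ∗ ν)) (u : ℝ) :
    P {ω | (u : EReal) < maxSurplus τ X ω} = ν (Ioi u) := by
  have := h.indep.isProbabilityMeasure
  have htail : ∀ v, 0 ≤ v → ν (Ioi v) = ENNReal.ofReal r * (tailMeasure G ∗ ν) (Ioi v) := by
    intro v hv
    conv_lhs => rw [hν]
    simp [hv]
  have hmean := h.lintegral_stoppedCapital hr (measurable_measure_Ioi ν)
    (fun z hz => lintegral_tail_eq_self hr ν G hG htail hz) u
  let R : Set Ω := {ω | (u : EReal) < maxSurplus τ X ω}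
  have hlim : ∀ᵐ ω ∂P, Tendsto
      (fun n => ν (Ioi (stoppedCapital u (fun i => τ i ω) (fun i => X i ω) n))) atTop
        (𝓝 (R.indicator 1 ω)) := by
    filter_upwards [h.ae_lt_maxSurplus_iff hr, h.ae_tendsto_interarrival hr,
      h.ae_tendsto_claim hint] with ω h1 h2 h3
    by_cases hω : ω ∈ R
    · obtain ⟨k, hk⟩ := exists_stoppedCapital_neg ((h1 u).1 hω)
      rw [indicator_of_mem hω]
      refine tendsto_const_nhds.congr' ?_
      filter_upwards [eventually_ge_atTop k] with n hn
      rw [measure_Ioi_of_neg ν hν0 (stoppedCapital_neg_mono hn hk)]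
      rfl
    · have h4 : ∀ k, surplusWalk (fun i => τ i ω) (fun i => X i ω) k ≤ u := by
        simpa using mt (h1 u).2 hω
      rw [indicator_of_notMem hω]
      refine (tendsto_measure_Ioi_atTop ν).comp (Tendsto.congr (fun n =>
        (stoppedCapital_eq_of_forall_le (n := n) fun k _ => h4 k).symm) ?_)
      simp_rw [sub_eq_add_neg u]
      refine tendsto_atTop_add_const_left _ _ (tendsto_atTop_of_tendsto_average
        (c := r⁻¹ - ∫ x, x ∂G) ?_ ((h2.sub h3).congr fun n => ?_))
      · rw [sub_pos, ← one_div, lt_div_iff₀' hr]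
        exact hρ
      · rw [surplusWalk, neg_sub, sub_div]
  have hR : NullMeasurableSet R P := by
    have hmeas : AEMeasurable (R.indicator (1 : Ω → ℝ≥0∞)) P :=
      aemeasurable_of_tendsto_metrizable_ae atTop
        (fun n => (measurable_measure_Ioi ν).comp_aemeasurable
          (h.aemeasurable_stoppedCapital u n)) hlim
    exact aemeasurable_indicator_const_iff (1 : ℝ≥0∞) |>.1 hmeas
  have hdom := tendsto_lintegral_of_dominated_convergence' (fun _ => 1)
    (fun n => (measurable_measure_Ioi ν).comp_aemeasurable (h.aemeasurable_stoppedCapital u n))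
    (fun n => ae_of_all _ fun ω => prob_le_one) (by simp) hlim
  rw [lintegral_indicator_one₀ hR] at hdom
  exact tendsto_nhds_unique hdom (tendsto_const_nhds.congr fun n => (hmean n).symm)

end CramerLundberg

/-! ### Renewal equations and compound geometric laws -/

lemma conv_Iio_zero {μ ν : Measure ℝ} [SFinite μ] [SFinite ν] (hμ : μ (Iio 0) = 0)
    (hν : ν (Iio 0) = 0) : (μ ∗ ν) (Iio 0) = 0 := by
  rw [Measure.conv, Measure.map_apply measurable_add measurableSet_Iio]
  have hsub : (fun p : ℝ × ℝ => p.1 + p.2) ⁻¹' Iio 0 ⊆ Iio 0 ×ˢ univ ∪ univ ×ˢ Iio 0 := by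
    rintro ⟨x, y⟩ h
    simp only [mem_preimage, mem_Iio, mem_union, mem_prod, mem_univ, and_true, true_and] at h ⊢
    by_contra! h'
    linarith
  refine measure_mono_null hsub (measure_union_null ?_ ?_) <;> simp [Measure.prod_prod, hμ, hν]

/-- Adding an independent non-negative variable makes the tail heavier. -/
lemma measure_Ioi_le_conv (μ ν : Measure ℝ) [IsProbabilityMeasure μ] [SFinite ν]
    (hμ : μ (Iio 0) = 0) (u : ℝ) : ν (Ioi u) ≤ (μ ∗ ν) (Ioi u) := by
  rw [Measure.conv, Measure.map_apply measurable_add measurableSet_Ioi]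
  calc ν (Ioi u) = (μ.prod ν) (Ici 0 ×ˢ Ioi u) := by
        rw [Measure.prod_prod, ← compl_Iio, (prob_compl_eq_one_iff measurableSet_Iio).2 hμ, one_mul]
    _ ≤ _ := by
        refine measure_mono ?_
        rintro ⟨x, y⟩ ⟨hx, hy⟩
        simp only [mem_Ici, mem_Ioi, mem_preimage] at hx hy ⊢
        linarith

lemma conv_sum (μ : Measure ℝ) (l : ℕ → Measure ℝ) [∀ n, SFinite (l n)] :
    μ ∗ Measure.sum l = Measure.sum fun n => μ ∗ l n := by
  simp only [Measure.conv]
  rw [Measure.prod_sum_right, Measure.map_sum measurable_add.aemeasurable]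

/-- A sum of measures which arise from each other by convolution with `η` solves a renewal
equation. -/
lemma sum_eq_add_conv_sum (η : Measure ℝ) (l : ℕ → Measure ℝ) [∀ n, SFinite (l n)]
    (hl : ∀ n, l (n + 1) = η ∗ l n) :
    Measure.sum l = l 0 + η ∗ Measure.sum l := by
  rw [conv_sum]
  ext s hs
  rw [Measure.add_apply, Measure.sum_apply _ hs, Measure.sum_apply _ hs,
    tsum_eq_zero_add' ENNReal.summable]
  simp only [hl]

lemma ofReal_one_sub_mul_tsum {a : ℝ} (ha0 : 0 ≤ a) (ha1 : a < 1) :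
    ENNReal.ofReal (1 - a) * ∑' n : ℕ, ENNReal.ofReal a ^ n = 1 := by
  rw [ENNReal.tsum_geometric, ENNReal.ofReal_sub _ ha0, ENNReal.ofReal_one]
  refine ENNReal.mul_inv_cancel ?_ (by simp)
  rw [← ENNReal.ofReal_one, ← ENNReal.ofReal_sub _ ha0]
  simpa using ha1

/-- The `n`-fold convolution power of a measure. -/
noncomputable def convPow (η : Measure ℝ) : ℕ → Measure ℝ
  | 0 => Measure.dirac 0
  | n + 1 => η ∗ convPow η n

instance isFiniteMeasure_convPow (η : Measure ℝ) [IsFiniteMeasure η] (n : ℕ) :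
    IsFiniteMeasure (convPow η n) := by
  induction n with
  | zero => rw [convPow]; infer_instance
  | succ n ih => rw [convPow]; infer_instance

lemma convPow_univ (η : Measure ℝ) [IsFiniteMeasure η] (n : ℕ) :
    convPow η n univ = η univ ^ n := by
  induction n with
  | zero => simp [convPow]
  | succ n ih =>
    rw [convPow, Measure.conv, Measure.map_apply measurable_add .univ, preimage_univ,
      ← univ_prod_univ, Measure.prod_prod, ih, pow_succ']

lemma convPow_Iio_zero {η : Measure ℝ} [IsFiniteMeasure η] (hη : η (Iio 0) = 0) (n : ℕ) :
    convPow η n (Iio 0) = 0 := by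
  induction n with
  | zero => simp [convPow]
  | succ n ih => exact conv_Iio_zero hη ih

/-- The defective renewal equation with kernel `η` of mass `a < 1` is solved by a probability
measure on `[0, ∞)`, the compound geometric law `(1 - a) ∑ n, η ^ n`. -/
lemma exists_renewal_solution (η : Measure ℝ) [IsFiniteMeasure η] (hη : η (Iio 0) = 0) {a : ℝ}
    (ha0 : 0 ≤ a) (ha1 : a < 1) (ha : η univ = ENNReal.ofReal a) :
    ∃ ν : Measure ℝ, IsProbabilityMeasure ν ∧ ν (Iio 0) = 0 ∧
      ν = ENNReal.ofReal (1 - a) • Measure.dirac 0 + η ∗ ν := by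
  refine ⟨ENNReal.ofReal (1 - a) • Measure.sum (convPow η), ⟨?_⟩, ?_, ?_⟩
  · simp only [Measure.smul_apply, Measure.sum_apply _ MeasurableSet.univ, convPow_univ, ha,
      smul_eq_mul]
    exact ofReal_one_sub_mul_tsum ha0 ha1
  · simp [Measure.sum_apply _ measurableSet_Iio, convPow_Iio_zero hη]
  · rw [Measure.conv_smul_right, ← smul_add]
    exact congrArg _ (sum_eq_add_conv_sum η (convPow η) fun n => rfl)

/-- The change of renewal kernel: a compound geometric sum of variables with law `κ`, with
independent copies of a compound geometric law `ν` with kernel `η` in between, is again compound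
geometric, with the combined kernel. -/
lemma renewal_combine {α β γ : ℝ≥0∞} {η κ ν W : Measure ℝ} [SFinite η] [SFinite κ] [SFinite ν]
    [SFinite W] (hν : ν = α • Measure.dirac 0 + η ∗ ν)
    (hW : W = β • ν + (γ • (ν ∗ κ)) ∗ W) :
    W = (β * α) • Measure.dirac 0 + (η + (γ * α) • κ) ∗ W := by
  have hW' : W = β • ν + γ • (ν ∗ (κ ∗ W)) := by
    conv_lhs => rw [hW]
    rw [Measure.conv_smul_left, Measure.conv_assoc]
  have hηW : η ∗ W = β • (η ∗ ν) + γ • ((η ∗ ν) ∗ (κ ∗ W)) := by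
    conv_lhs => rw [hW']
    rw [Measure.conv_add, Measure.conv_smul_right, Measure.conv_smul_right, ← Measure.conv_assoc η]
  have hνκ : ν ∗ (κ ∗ W) = α • (κ ∗ W) + (η ∗ ν) ∗ (κ ∗ W) := by
    conv_lhs => rw [hν]
    rw [Measure.add_conv, Measure.conv_smul_left, Measure.dirac_zero_conv]
  rw [Measure.add_conv, hηW, Measure.conv_smul_left]
  have hβ : β • ν = β • α • Measure.dirac 0 + β • (η ∗ ν) := by
    conv_lhs => rw [hν, smul_add]
  conv_lhs => rw [hW', hβ, hνκ, smul_add]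
  rw [mul_smul, mul_smul]
  abel

/-! ### Mixtures and excess laws -/

section Mixture

variable {ε : ℝ} {F H : Measure ℝ}

lemma isProbabilityMeasure_mixture (hε0 : 0 ≤ ε) (hε1 : ε ≤ 1) [IsProbabilityMeasure F]
    [IsProbabilityMeasure H] : IsProbabilityMeasure (mixture ε F H) := by
  constructor
  simp only [mixture, Measure.add_apply, Measure.smul_apply, measure_univ, smul_eq_mul, mul_one]
  rw [← ENNReal.ofReal_add (by linarith) hε0]
  simp

lemma mixture_Iio_zero (hF : F (Iio 0) = 0) (hH : H (Iio 0) = 0) :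
    mixture ε F H (Iio 0) = 0 := by
  simp [mixture, hF, hH]

lemma integrable_id_mixture (hF : Integrable (fun x : ℝ => x) F)
    (hH : Integrable (fun x : ℝ => x) H) : Integrable (fun x : ℝ => x) (mixture ε F H) :=
  (hF.smul_measure ENNReal.ofReal_ne_top).add_measure (hH.smul_measure ENNReal.ofReal_ne_top)

lemma integral_id_mixture (hε0 : 0 ≤ ε) (hε1 : ε ≤ 1) (hF : Integrable (fun x : ℝ => x) F)
    (hH : Integrable (fun x : ℝ => x) H) :
    ∫ x, x ∂mixture ε F H = (1 - ε) * ∫ x, x ∂F + ε * ∫ x, x ∂H := by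
  rw [mixture, integral_add_measure (hF.smul_measure ENNReal.ofReal_ne_top)
    (hH.smul_measure ENNReal.ofReal_ne_top), integral_smul_measure, integral_smul_measure,
    ENNReal.toReal_ofReal hε0, ENNReal.toReal_ofReal (by linarith), smul_eq_mul, smul_eq_mul]

end Mixture

lemma tailMeasure_eq_smul_excessLaw {C : Measure ℝ} (hC : 0 < ∫ x, x ∂C) :
    tailMeasure C = ENNReal.ofReal (∫ x, x ∂C) • excessLaw C := by
  have h0 : ENNReal.ofReal (∫ x, x ∂C) ≠ 0 := by simpa using hC
  rw [excessLaw, ← withDensity_smul _ ((measurable_measure_Ioi C).div_const _), tailMeasure]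
  congr 1
  ext t
  rw [Pi.smul_apply, smul_eq_mul, ENNReal.mul_div_cancel h0 ENNReal.ofReal_ne_top]

lemma excessLaw_Iio_zero (C : Measure ℝ) : excessLaw C (Iio 0) = 0 := by
  have hac : excessLaw C ≪ volume.restrict (Ioi 0) := withDensity_absolutelyContinuous _ _
  refine hac ?_
  rw [Measure.restrict_apply measurableSet_Iio]
  have : Iio (0 : ℝ) ∩ Ioi 0 = ∅ := by ext x; simp; intro h; exact h.le
  simp [this]

/-! ### Compound sums and their tails -/

section Sums

variable {Ω : Type*} [MeasurableSpace Ω] {Q : Measure Ω} {M E : ℕ → Ω → ℝ} {ν κ : Measure ℝ}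

/-- The sum `M 0 + ⋯ + M n + E 0 + ⋯ + E (n - 1)`, whose tail is `tailL`. -/
def compoundSum (M E : ℕ → Ω → ℝ) (n : ℕ) (ω : Ω) : ℝ :=
  (∑ i ∈ Finset.range (n + 1), M i ω) + ∑ i ∈ Finset.range n, E i ω

lemma aemeasurable_compoundSum (hM : ∀ i, HasLaw (M i) ν Q) (hE : ∀ i, HasLaw (E i) κ Q)
    (n : ℕ) : AEMeasurable (compoundSum M E n) Q :=
  (Finset.aemeasurable_fun_sum _ fun i _ => (hM i).aemeasurable).add
    (Finset.aemeasurable_fun_sum _ fun i _ => (hE i).aemeasurable)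

lemma map_compoundSum_zero (hM : ∀ i, HasLaw (M i) ν Q) :
    Q.map (compoundSum M E 0) = ν := by
  rw [← (hM 0).map_eq]
  congr 1
  ext ω
  simp [compoundSum]

lemma map_compoundSum_succ (hM : ∀ i, HasLaw (M i) ν Q) (hE : ∀ i, HasLaw (E i) κ Q)
    (hind : iIndepFun (Sum.elim M E) Q) (n : ℕ) :
    Q.map (compoundSum M E (n + 1)) = (ν ∗ κ) ∗ Q.map (compoundSum M E n) := by
  classical
  have := hind.isProbabilityMeasure
  have hm : ∀ i, AEMeasurable (Sum.elim M E i) Q := by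
    rintro (i | i)
    exacts [(hM i).aemeasurable, (hE i).aemeasurable]
  have hν : IsProbabilityMeasure ν := (hM 0).map_eq ▸ Measure.isProbabilityMeasure_map (hm (.inl 0))
  have hκ : IsProbabilityMeasure κ := (hE 0).map_eq ▸ Measure.isProbabilityMeasure_map (hm (.inr 0))
  have hσ := Measure.isProbabilityMeasure_map (aemeasurable_compoundSum hM hE n)
  let s : Finset (ℕ ⊕ ℕ) := (Finset.range (n + 1)).disjSum (Finset.range n)
  let s' : Finset (ℕ ⊕ ℕ) := (Finset.range (n + 2)).disjSum (Finset.range n)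
  have h1 := (hind.indepFun_finsetSum_of_notMem₀ hm (s := s) (i := Sum.inl (n + 1))
    (by simp [s])).map_add_eq_map_conv_map₀ (Finset.aemeasurable_sum _ fun i _ => hm i) (hm _)
  have h2 := (hind.indepFun_finsetSum_of_notMem₀ hm (s := s') (i := Sum.inr n)
    (by simp [s'])).map_add_eq_map_conv_map₀ (Finset.aemeasurable_sum _ fun i _ => hm i) (hm _)
  have e1 : ∑ i ∈ s, Sum.elim M E i = compoundSum M E n := by
    ext ω
    simp [s, compoundSum, Finset.sum_disjSum]
  have e2 : ∑ i ∈ s', Sum.elim M E i = ∑ i ∈ s, Sum.elim M E i + M (n + 1) := by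
    simp only [s, s', Finset.sum_disjSum, Sum.elim_inl, Sum.elim_inr,
      Finset.sum_range_succ _ (n + 1)]
    abel
  have e3 : compoundSum M E (n + 1) = ∑ i ∈ s', Sum.elim M E i + E n := by
    ext ω
    simp [s', compoundSum, Finset.sum_disjSum, Finset.sum_range_succ _ n, add_assoc]
  rw [e1, Sum.elim_inl, (hM _).map_eq] at h1
  rw [Sum.elim_inr, (hE _).map_eq, e2, e1, h1] at h2
  rw [e3, e2, e1, h2, Measure.conv_assoc, Measure.conv_comm]

lemma tailL_eq (hM : ∀ i, HasLaw (M i) ν Q) (hE : ∀ i, HasLaw (E i) κ Q) (n : ℕ) (u : ℝ) :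
    tailL Q M E n u = (Q.map (compoundSum M E n)).real (Ioi u) := by
  rw [map_measureReal_apply_of_aemeasurable (aemeasurable_compoundSum hM hE n) measurableSet_Ioi]
  rfl

end Sums

/-! ### Error bounds -/

/-- The geometric mean of a monotone sequence in `[0, 1]`, compared with its first terms. -/
lemma geometric_mean_bounds {L : ℕ → ℝ} (hmono : Monotone L) (h1 : ∀ n, L n ≤ 1)
    {c ψ : ℝ} (hc0 : 0 ≤ c) (hc1 : c < 1) (hψ : HasSum (fun n => (1 - c) * (c ^ n * L n)) ψ) :
    c ^ 2 * (L 2 - L 1) ≤ ψ - (L 0 + c * (L 1 - L 0)) ∧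
      ψ - (L 0 + c * (L 1 - L 0)) ≤ c ^ 2 * (1 - L 1) := by
  have htail := (hasSum_nat_add_iff' 2).2 hψ
  have hgeom (K : ℝ) : HasSum (fun n => (1 - c) * (c ^ (n + 2) * K)) (c ^ 2 * K) := by
    have h := (hasSum_geometric_of_lt_one hc0 hc1).mul_left ((1 - c) * c ^ 2 * K)
    have hc : 1 - c ≠ 0 := by linarith
    rw [show (1 - c) * c ^ 2 * K * (1 - c)⁻¹ = c ^ 2 * K by field_simp] at h
    exact h.congr_fun fun n => by ring
  have hle {x y : ℝ} (n : ℕ) (h : x ≤ y) :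
      (1 - c) * (c ^ (n + 2) * x) ≤ (1 - c) * (c ^ (n + 2) * y) :=
    mul_le_mul_of_nonneg_left (mul_le_mul_of_nonneg_left h (pow_nonneg hc0 _)) (by linarith)
  have hlow := hasSum_le (fun n => hle n (hmono (Nat.le_add_left 2 n))) (hgeom (L 2)) htail
  have hup := hasSum_le (fun n => hle n (h1 (n + 2))) htail (hgeom 1)
  simp only [Finset.sum_range_succ, Finset.sum_range_zero, pow_zero, pow_one] at hlow hup
  constructor <;> linarith

end RiskModel

open Set RiskModel in
theorem theoremt
    -- arrival rate, perturbation parameter, and the laws of the two kinds of claims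
    (r ε δ θ : ℝ) (hr : 0 < r) (hε0 : 0 ≤ ε) (hε1 : ε ≤ 1)
    (B C : Measure ℝ) [IsProbabilityMeasure B] [IsProbabilityMeasure C]
    (hB : B (Set.Iio 0) = 0) (hC : C (Set.Iio 0) = 0)
    (hBint : Integrable (fun x : ℝ => x) B) (hCint : Integrable (fun x : ℝ => x) C)
    (hCpos : 0 < ∫ x, x ∂C)
    (hδ : δ = r * ∫ x, x ∂B) (hθ : θ = r * ∫ x, x ∂C)
    -- stability condition
    (hρ : (1 - ε) * δ + ε * θ < 1)
    -- the risk model with mixture claim sizes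
    {Ω : Type*} [MeasurableSpace Ω] (P : Measure Ω) [IsProbabilityMeasure P]
    (τ X : ℕ → Ω → ℝ) (hX : RiskModel.IsCramerLundberg P r (RiskModel.mixture ε B C) τ X)
    -- the base model in which the claims with law `C` are discarded
    {Ω' : Type*} [MeasurableSpace Ω'] (P' : Measure Ω') [IsProbabilityMeasure P']
    (τ' X' : ℕ → Ω' → ℝ) (hX' : RiskModel.IsCramerLundberg P' r (RiskModel.discardLaw ε B) τ' X')
    -- independent copies of the supremum of the base model and of the excess variables
    {Ω'' : Type*} [MeasurableSpace Ω''] (Q : Measure Ω'') [IsProbabilityMeasure Q]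
    (M E : ℕ → Ω'' → ℝ)
    (hM : ∀ i, IdentDistrib (fun ω => (M i ω : EReal)) (RiskModel.maxSurplus τ' X') Q P')
    (hE : ∀ i, HasLaw (E i) (RiskModel.excessLaw C) Q)
    (hind : iIndepFun (Sum.elim M E) Q)
    -- initial capital
    (u : ℝ) (hu : 0 ≤ u) :
    RiskModel.correctedDiscard Q M E (RiskModel.ruinProb P' τ' X') ε δ θ u
        ≤ RiskModel.ruinProb P τ X u ∧
      RiskModel.corrCoeff ε δ θ ^ 2 * (RiskModel.tailL Q M E 2 u - RiskModel.tailL Q M E 1 u)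
        ≤ RiskModel.ruinProb P τ X u
          - RiskModel.correctedDiscard Q M E (RiskModel.ruinProb P' τ' X') ε δ θ u ∧
      RiskModel.ruinProb P τ X u
          - RiskModel.correctedDiscard Q M E (RiskModel.ruinProb P' τ' X') ε δ θ u
        ≤ RiskModel.corrCoeff ε δ θ ^ 2 := by
  have hB0 : 0 ≤ ∫ x, x ∂B := integral_nonneg_of_ae (by
    rw [Filter.EventuallyLE, ae_iff]; simpa [Iio] using hB)
  have hε' : 0 ≤ 1 - ε := by linarith
  have hθ0 : 0 < θ := hθ ▸ mul_pos hr hCpos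
  have hεθ : 0 ≤ ε * θ := by positivity
  -- The traffic intensity of the discard model; the identity `hca` below expresses that of the
  -- claims with law `C` through it.
  set a := (1 - ε) * δ with ha
  have ha0 : 0 ≤ a := by rw [ha, hδ]; positivity
  have ha1 : a < 1 := by linarith
  set c := corrCoeff ε δ θ with hc
  have hca : c * (1 - a) = ε * θ := by
    have : 1 - δ + ε * δ = 1 - a := by rw [ha]; ring
    rw [hc, corrCoeff, this, div_mul_cancel₀ _ (by linarith)]
  have hc0 : 0 ≤ c := nonneg_of_mul_nonneg_left (hca ▸ hεθ) (by linarith)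
  have hc1 : c < 1 := by
    by_contra! h
    nlinarith
  -- The law `ν` of the maximal surplus of the discard model.
  have hd := isProbabilityMeasure_mixture (F := B) (H := Measure.dirac 0) hε0 hε1
  change IsProbabilityMeasure (discardLaw ε B) at hd
  have hdirac : Integrable (fun x : ℝ => x) (Measure.dirac 0) := integrable_dirac (by simp)
  have hdmean : r * ∫ x, x ∂discardLaw ε B = a := by
    rw [discardLaw, integral_id_mixture hε0 hε1 hBint hdirac, integral_dirac, ha, hδ]
    ring
  set η := ENNReal.ofReal r • tailMeasure (discardLaw ε B) with hη
  have hηmass : η univ = ENNReal.ofReal a := by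
    rw [hη, Measure.smul_apply, tailMeasure_univ (discardLaw ε B) (mixture_Iio_zero hB (by simp))
      (integrable_id_mixture hBint hdirac), smul_eq_mul, ← ENNReal.ofReal_mul hr.le, hdmean]
  have hηfin : IsFiniteMeasure η := ⟨by rw [hηmass]; exact ENNReal.ofReal_lt_top⟩
  obtain ⟨ν, hνprob, hν0, hν⟩ := exists_renewal_solution η
    (by rw [hη, Measure.smul_apply, tailMeasure_Iio, smul_zero]) ha0 ha1 hηmass
  have hνmax (v : ℝ) := hX'.measure_lt_maxSurplus hr (mixture_Iio_zero hB (by simp))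
    (integrable_id_mixture hBint hdirac) (hdmean.trans_lt ha1) ν hν0
    (by rw [← Measure.conv_smul_left]; exact hν) v
  have hMaem (i : ℕ) : AEMeasurable (M i) Q :=
    measurable_ereal_toReal.comp_aemeasurable (hM i).aemeasurable_fst
  have hMtail (i : ℕ) (v : ℝ) : Q {ω | v < M i ω} = ν (Ioi v) := by
    rw [← hνmax v]
    simpa [preimage] using (hM i).measure_mem_eq (measurableSet_Ioi (a := (v : EReal)))
  have hMlaw (i : ℕ) : HasLaw (M i) ν Q := by
    refine ⟨hMaem i, ?_⟩
    have := Measure.isProbabilityMeasure_map (hMaem i)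
    refine Measure.ext_of_Iic _ _ fun v => ?_
    rw [← compl_Ioi, prob_compl_eq_one_sub measurableSet_Ioi,
      prob_compl_eq_one_sub measurableSet_Ioi,
      Measure.map_apply_of_aemeasurable (hMaem i) measurableSet_Ioi, ← hMtail i v]
    rfl
  -- The law `W` of the maximal surplus of the mixture model, as a compound geometric sum.
  have hκprob : IsProbabilityMeasure (excessLaw C) :=
    (hE 0).map_eq ▸ Measure.isProbabilityMeasure_map (hE 0).aemeasurable
  set κ := excessLaw C
  let σ : ℕ → Measure ℝ := fun n => Q.map (compoundSum M E n)
  have hσprob (n : ℕ) : IsProbabilityMeasure (σ n) :=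
    Measure.isProbabilityMeasure_map (aemeasurable_compoundSum hMlaw hE n)
  have hσ0 : σ 0 = ν := map_compoundSum_zero hMlaw
  have hσsucc (n : ℕ) : σ (n + 1) = (ν ∗ κ) ∗ σ n := map_compoundSum_succ hMlaw hE hind n
  have hνκ : (ν ∗ κ) (Iio 0) = 0 := conv_Iio_zero hν0 (excessLaw_Iio_zero C)
  have hσneg (n : ℕ) : σ n (Iio 0) = 0 := by
    induction n with
    | zero => rw [hσ0, hν0]
    | succ n ih => rw [hσsucc]; exact conv_Iio_zero hνκ ih
  let l : ℕ → Measure ℝ := fun n => ENNReal.ofReal c ^ n • σ n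
  set W := ENNReal.ofReal (1 - c) • Measure.sum l with hW
  have hWapply {s : Set ℝ} (hs : MeasurableSet s) :
      W s = ENNReal.ofReal (1 - c) * ∑' n, ENNReal.ofReal c ^ n * σ n s := by
    simp [hW, l, Measure.sum_apply _ hs]
  have hWprob : IsProbabilityMeasure W := ⟨by
    rw [hWapply .univ]
    simpa using ofReal_one_sub_mul_tsum hc0 hc1⟩
  have hWneg : W (Iio 0) = 0 := by
    rw [hWapply measurableSet_Iio]
    simp [hσneg]
  have hWrenew : W = ENNReal.ofReal (1 - c) • ν + (ENNReal.ofReal c • (ν ∗ κ)) ∗ W := by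
    have h := sum_eq_add_conv_sum (ENNReal.ofReal c • (ν ∗ κ)) l fun n => by
      simp only [l]
      rw [hσsucc, Measure.conv_smul_left, Measure.conv_smul_right, smul_smul, pow_succ']
    have h0 : l 0 = ν := by simp [l, hσ0]
    rw [h0] at h
    conv_lhs => rw [hW, h]
    rw [smul_add, hW, Measure.conv_smul_right]
  have hWmix : W = (ENNReal.ofReal (1 - c) * ENNReal.ofReal (1 - a)) • Measure.dirac 0
      + ENNReal.ofReal r • (tailMeasure (mixture ε B C) ∗ W) := by
    have h := renewal_combine hν hWrenew
    have hk : ENNReal.ofReal r • tailMeasure (mixture ε B C)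
        = η + (ENNReal.ofReal c * ENNReal.ofReal (1 - a)) • κ := by
      rw [tailMeasure_mixture, tailMeasure_eq_smul_excessLaw hCpos, smul_add, hη,
        tailMeasure_discardLaw, smul_smul _ _ (excessLaw C), smul_smul _ _ (excessLaw C),
        ← ENNReal.ofReal_mul hc0, hca, ← ENNReal.ofReal_mul hε0, ← ENNReal.ofReal_mul hr.le, hθ]
      congr 3
      ring
    rw [← Measure.conv_smul_left, hk]
    exact h
  have hmprob := isProbabilityMeasure_mixture (F := B) (H := C) hε0 hε1
  have hψ : P {ω | (u : EReal) < maxSurplus τ X ω} = W (Ioi u) := by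
    refine hX.measure_lt_maxSurplus hr (mixture_Iio_zero hB hC)
      (integrable_id_mixture hBint hCint) ?_ W hWneg hWmix u
    rw [integral_id_mixture hε0 hε1 hBint hCint]
    calc _ = a + ε * θ := by rw [ha, hδ, hθ]; ring
      _ < 1 := hρ
  -- In terms of tails: a geometric mean of the monotone sequence `tailL`.
  let L : ℕ → ℝ := fun n => tailL Q M E n u
  have hL (n : ℕ) : L n = (σ n).real (Ioi u) := tailL_eq hMlaw hE n u
  have hLmono : Monotone L := monotone_nat_of_le_succ fun n => by
    rw [hL, hL, hσsucc]
    exact ENNReal.toReal_mono (measure_ne_top _ _) (measure_Ioi_le_conv _ _ hνκ u)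
  have hL1 (n : ℕ) : L n ≤ 1 := hL n ▸ measureReal_le_one
  have hL0 : 0 ≤ L 1 := measureReal_nonneg
  have hsum : HasSum (fun n => (1 - c) * (c ^ n * L n)) (ruinProb P τ X u) := by
    have hfin : ∑' n, ENNReal.ofReal (1 - c) * (ENNReal.ofReal c ^ n * σ n (Ioi u)) ≠ ⊤ := by
      rw [ENNReal.tsum_mul_left, ← hWapply measurableSet_Ioi]
      exact measure_ne_top _ _
    have h := ENNReal.hasSum_toReal hfin
    rw [← ENNReal.tsum_toReal_eq (ENNReal.ne_top_of_tsum_ne_top hfin), ENNReal.tsum_mul_left,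
      ← hWapply measurableSet_Ioi, ← hψ] at h
    refine h.congr_fun fun n => ?_
    rw [hL, ENNReal.toReal_mul, ENNReal.toReal_mul, ENNReal.toReal_pow,
      ENNReal.toReal_ofReal hc0, ENNReal.toReal_ofReal (by linarith)]
    rfl
  have hcorr : correctedDiscard Q M E (ruinProb P' τ' X') ε δ θ u = L 0 + c * (L 1 - L 0) := by
    have h0 : L 0 = Q.real {ω | u < M 0 ω} := by simp [L, tailL]
    have h1 : L 1 = Q.real {ω | u < M 0 ω + M 1 ω + E 0 ω} := by
      simp [L, tailL, Finset.sum_range_succ]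
    have h2 : ruinProb P' τ' X' u = L 0 := by
      rw [h0, ruinProb, measureReal_def, measureReal_def, hνmax, hMtail]
    rw [correctedDiscard, h2, ← h0, ← h1]
  obtain ⟨hlow, hup⟩ := geometric_mean_bounds hLmono hL1 hc0 hc1 hsum
  have hstep : L 1 ≤ L 2 := hLmono one_le_two
  rw [hcorr]
  refine ⟨?_, hlow, ?_⟩
  · nlinarith [mul_nonneg (sq_nonneg c) (sub_nonneg.2 hstep)]
  · nlinarith [mul_nonneg (sq_nonneg c) hL0]
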